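/- Let $G$ be a graph, i.e. a finite connected CW complex of dimension at most $1$ (loops and multiple edges allowed), and for $n \ge 0$ let $\mathrm{Conf}_n(G) = \{(x_1,\dots,x_n)\in G^n : x_i\ne x_j \text{ for } i\ne j\}$ with the subspace topology of $G^n$. An identifying function is a continuous map $f:\mathrm{Conf}_n(G)\to G$ with $f(x_1,\dots,x_n)\neq x_j$ for every $(x_1,\dots,x_n)\in\mathrm{Conf}_n(G)$ and every $j$. A section is a continuous map $s:\mathrm{Conf}_n(G)\to \mathrm{Conf}_{n+1}(G)$ with $\phi\circ s=\mathrm{id}$, where $\phi(x_1,\dots,x_{n+1})=(x_1,\dots,x_n)$. A connected component $C$ of $G\setminus\{w\}$ is said to be connected to the vertex $w$ at least twice if at least two ends at $w$ of edges of $G$ belong to edges whose interior lies in $C$ (a loop at $w$ has two ends at $w$). Suppose that $G$ has a vertex $w$ such that at least $k$ connected components of $G\setminus\{w\}$ are connected to $w$ at least twice. Then for every $n\le k$ there is an identifying function $\mathrm{Conf}_n(G)\to G$, and hence a section $\mathrm{Conf}_n(G)\to\mathrm{Conf}_{n+1}(G)$. -/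

import Mathlib

open Set Metric Topology

namespace GraphConf

/-- The `n`-th ordered configuration space, with the subspace topology of the product `X ^ n`. -/
abbrev Conf (n : ℕ) (X : Type*) : Type _ := {x : Fin n → X // Function.Injective x}

/-- The forgetting map `(x₁, …, xₙ₊₁) ↦ (x₁, …, xₙ)`. -/
def forget (n : ℕ) (X : Type*) (x : Conf (n + 1) X) : Conf n X :=
  ⟨fun i => x.1 i.castSucc, x.2.comp (Fin.castSucc_injective n)⟩

/-- A section of the forgetting map. -/
def IsSection (n : ℕ) (X : Type*) [TopologicalSpace X] (s : Conf n X → Conf (n + 1) X) : Prop :=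
  Continuous s ∧ forget n X ∘ s = id

/-- An identifying function: a continuous map whose value differs from every token of the
configuration. -/
def IsIdentifyingFunction (n : ℕ) (X : Type*) [TopologicalSpace X] (f : Conf n X → X) : Prop :=
  Continuous f ∧ ∀ (x : Conf n X) (j : Fin n), f x ≠ x.1 j

section Graph

variable (G : Type*) [TopologicalSpace G] [CWComplex (univ : Set G)]

/-- A graph: a finite connected Hausdorff CW complex without cells of dimension at least two. -/
structure IsGraph : Prop where
  t2 : T2Space G
  connected : ConnectedSpace G
  finite : CWComplex.Finite (univ : Set G)
  dim_le_one : ∀ m : ℕ, 2 ≤ m → IsEmpty (RelCWComplex.cell (univ : Set G) m)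

variable {G}

/-- `w` is a vertex, that is, the point of a zero-cell. -/
def IsVertex (w : G) : Prop :=
  ∃ v : RelCWComplex.cell (univ : Set G) 0, RelCWComplex.closedCell 0 v = {w}

/-- The ends at `w` of edges running in `C`. An edge `e` has the two ends `(e, -1)` and `(e, 1)`,
the points of `sphere 0 1` in `Fin 1 → ℝ`; so a loop at `w` has two ends at `w`. -/
def edgeEnds (w : G) (C : Set G) : Set (RelCWComplex.cell (univ : Set G) 1 × (Fin 1 → ℝ)) :=
  {p | p.2 ∈ sphere (0 : Fin 1 → ℝ) 1 ∧ RelCWComplex.map 1 p.1 p.2 = w ∧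
    RelCWComplex.openCell 1 p.1 ⊆ C}

/-- The connected components of `G ∖ w` which are connected to `w` at least twice. -/
def doublyAttachedComponents (w : G) : Set (Set G) :=
  {C | (∃ x ∈ ({w}ᶜ : Set G), C = connectedComponentIn {w}ᶜ x) ∧ 2 ≤ (edgeEnds w C).encard}

end Graph

end GraphConf

/-! The new point rests at `w` and moves only when a token `j` comes close to `w`, relative to the
distances of the other tokens. At most one token can be that close. The other `n - 1` tokens cannot
meet all `n` disjoint components, so some doubly attached component is free of them, and the new
point hides there.

Double attachment lets it leave `w` and return without meeting token `j`. Take the midpoint of an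
edge in the component with an end at `w`. One path to `w` follows the half edge (the arm); the other
goes through the component to a different end at `w` and avoids the arm. If the token is in the arm
the second path is used, otherwise the first. A phase, zero when the token is at `w` and one at the
threshold of closeness, gives the time along the path. The choice of path can change only with the
token at the midpoint, which is too far away to occur, or at `w`, where both paths are at their
common start.

`exists_isIdentifyingFunction_of_evasionLoops` does this gluing in any space;
`IsGraph.nonempty_evasionLoop` builds the two paths in a graph. -/

namespace GraphConf

/-! ### Evasion of a single token -/

/-- Membership in an open set is locally constant away from its frontier. -/
theorem eventually_mem_iff_of_closure_subset {X : Type*} [TopologicalSpace X] {A F : Set X}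
    (hA : IsOpen A) (hF : closure A ⊆ A ∪ F) {z : X} (hz : z ∉ F) :
    ∀ᶠ y in 𝓝 z, (y ∈ A ↔ z ∈ A) := by
  by_cases h : z ∈ A
  · filter_upwards [hA.mem_nhds h] with y hy
    simp [h, hy]
  · have : z ∈ (closure A)ᶜ := fun hc => (hF hc).elim h hz
    filter_upwards [isClosed_closure.isOpen_compl.mem_nhds this] with y hy
    exact iff_of_false (fun hyA => hy (subset_closure hyA)) h

/-- Two paths from a point of `D` to `w` inside `D ∪ {w}`: `retreat` runs along an open arm that
ends at `w`, and `escape` avoids the arm. -/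
structure EvasionLoop {X : Type*} [TopologicalSpace X] (w : X) (D : Set X) where
  base : X
  arm : Set X
  escape : Path base w
  retreat : Path base w
  base_mem : base ∈ D
  isOpen_arm : IsOpen arm
  closure_arm : closure arm ⊆ arm ∪ {base, w}
  arm_subset : arm ⊆ D
  escape_mem : ∀ t, escape t ∈ insert w D
  escape_notMem_arm : ∀ t, escape t ∉ arm
  retreat_mem : ∀ t, retreat t ∈ insert w (insert base arm)

namespace EvasionLoop

variable {X : Type*} [TopologicalSpace X] {w : X} {D : Set X} (L : EvasionLoop w D)

open Classical in
/-- The position at time `t` of the point that evades a token at `z` near `w`. -/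
noncomputable def evade (z : X) (t : ℝ) : X :=
  if z ∈ L.arm then L.escape.extend t else L.retreat.extend t

theorem evade_zero (z : X) : L.evade z 0 = L.base := by
  unfold evade; split_ifs <;> simp

theorem evade_mem (z : X) (t : ℝ) : L.evade z t ∈ insert w D := by
  unfold evade
  split_ifs
  · exact L.escape_mem _
  · rcases L.retreat_mem (projIcc 0 1 zero_le_one t) with h | h | h
    · exact Or.inl h
    · exact Or.inr (mem_of_eq_of_mem h L.base_mem)
    · exact Or.inr (L.arm_subset h)

/-- Each path is used only when the token is off it: `escape` misses the arm, and `retreat` stays in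
the arm apart from `w` and `base`. -/
theorem evade_ne {z : X} (hzw : z ≠ w) (hzb : z ≠ L.base) (t : ℝ) : L.evade z t ≠ z := by
  unfold evade
  split_ifs with h
  · intro he
    exact L.escape_notMem_arm (projIcc 0 1 zero_le_one t) (by rwa [← he] at h)
  · intro he
    rcases L.retreat_mem (projIcc 0 1 zero_le_one t) with h' | h' | h'
    · exact hzw (he ▸ h')
    · exact hzb (he ▸ h')
    · exact h (he ▸ h')

/-- The arm has its frontier in `{base, w}`, so away from these points the choice of path is locally
constant. At `w` the time is zero and both paths tend to `base`. -/
theorem continuousAt_evade {Y : Type*} [TopologicalSpace Y] {z : Y → X} {t : Y → ℝ} {y : Y}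
    (hz : ContinuousAt z y) (ht : ContinuousAt t y) (hb : z y ≠ L.base)
    (h0 : z y = w → t y = 0) : ContinuousAt (fun y => L.evade (z y) (t y)) y := by
  classical
  have he : ContinuousAt (fun y => L.escape.extend (t y)) y :=
    L.escape.continuous_extend.continuousAt.comp ht
  have hr : ContinuousAt (fun y => L.retreat.extend (t y)) y :=
    L.retreat.continuous_extend.continuousAt.comp ht
  by_cases hw : z y = w
  · have ht0 := h0 hw
    simp only [ContinuousAt, ht0, Path.extend_zero, evade_zero] at he hr ⊢
    exact he.if' hr
  · have hev := hz.eventually (eventually_mem_iff_of_closure_subset L.isOpen_arm L.closure_arm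
      (z := z y) (by simp [hw, hb]))
    by_cases hA : z y ∈ L.arm
    · refine he.congr ?_
      filter_upwards [hev] with x hx
      simp [evade, hx, hA]
    · refine hr.congr ?_
      filter_upwards [hev] with x hx
      simp [evade, hx, hA]

end EvasionLoop

/-! ### Closeness of a token to the vertex -/

section Clearance

variable {X : Type*} {n : ℕ} (d : X → ℝ)

/-- Half the product of the distances of the tokens other than `j`. -/
noncomputable def clearance (j : Fin n) (x : Conf n X) : ℝ :=
  (∏ l ∈ Finset.univ.erase j, d (x.1 l)) / 2

/-- The time parameter of token `j`: zero when it sits at the vertex, at least one when it is not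
closer to the vertex than its clearance. -/
noncomputable def phase (j : Fin n) (x : Conf n X) : ℝ :=
  2 * d (x.1 j) / (clearance d j x + d (x.1 j))

variable {d} {w : X}

theorem clearance_nonneg (h0 : ∀ x, 0 ≤ d x) (j : Fin n) (x : Conf n X) : 0 ≤ clearance d j x :=
  div_nonneg (Finset.prod_nonneg fun _ _ => h0 _) zero_le_two

/-- The factor one half makes closeness exclusive: two close tokens would each be at less than half
the other's distance. -/
theorem clearance_le_half (h0 : ∀ x, 0 ≤ d x) (h1 : ∀ x, d x ≤ 1) {j l : Fin n} (hl : l ≠ j)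
    (x : Conf n X) : clearance d j x ≤ d (x.1 l) / 2 := by
  unfold clearance
  rw [← Finset.mul_prod_erase _ _ (Finset.mem_erase.2 ⟨hl, Finset.mem_univ l⟩)]
  have : ∏ i ∈ (Finset.univ.erase j).erase l, d (x.1 i) ≤ 1 :=
    Finset.prod_le_one (fun _ _ => h0 _) fun _ _ => h1 _
  have := mul_le_of_le_one_right (h0 (x.1 l)) this
  linarith

theorem clearance_le (h0 : ∀ x, 0 ≤ d x) (h1 : ∀ x, d x ≤ 1) (j : Fin n)
    (x : Conf n X) : clearance d j x ≤ 1 / 2 := by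
  unfold clearance
  have : ∏ i ∈ Finset.univ.erase j, d (x.1 i) ≤ 1 :=
    Finset.prod_le_one (fun _ _ => h0 _) fun _ _ => h1 _
  linarith

theorem clearance_pos (h0 : ∀ x, 0 ≤ d x) (hw : ∀ x, d x = 0 ↔ x = w) {j : Fin n} {x : Conf n X}
    (hj : x.1 j = w) : 0 < clearance d j x := by
  refine div_pos (Finset.prod_pos fun l hl => (h0 _).lt_of_ne' ?_) two_pos
  rw [ne_eq, hw, ← hj]
  exact fun h => Finset.ne_of_mem_erase hl (x.2 h)

theorem one_le_phase (h0 : ∀ x, 0 ≤ d x) (hw : ∀ x, d x = 0 ↔ x = w) {j : Fin n} {x : Conf n X}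
    (h : ¬ d (x.1 j) < clearance d j x) : 1 ≤ phase d j x := by
  have hpos : 0 < d (x.1 j) := by
    refine (h0 _).lt_of_ne' fun hz => h ?_
    rw [hz]
    exact clearance_pos h0 hw ((hw _).1 hz)
  have := clearance_nonneg h0 j x
  unfold phase
  rw [le_div_iff₀ (by linarith)]
  linarith

end Clearance

/-! ### Gluing evasion loops into an identifying function -/

section Identifying

variable {X : Type*} [TopologicalSpace X] {n : ℕ} {d : X → ℝ} {w : X}

theorem continuous_token (l : Fin n) : Continuous fun x : Conf n X => x.1 l :=
  (continuous_apply l).comp continuous_subtype_val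

theorem continuous_clearance (hd : Continuous d) (j : Fin n) : Continuous (clearance d j) := by
  
  unfold clearance
  exact (continuous_finsetProd _ fun l _ => hd.comp (continuous_token l)).div_const 2

/-- The denominator never vanishes: if token `j` is at `w`, injectivity keeps the others off `w`, so
the clearance is positive. -/
theorem continuous_phase (hd : Continuous d) (h0 : ∀ x, 0 ≤ d x) (hw : ∀ x, d x = 0 ↔ x = w)
    (j : Fin n) : Continuous (phase d j) := by
  have hc := continuous_clearance hd j
  have hj := hd.comp (continuous_token (X := X) j)
  unfold phase
  refine Continuous.div (continuous_const.mul hj) (hc.add hj) fun x => ?_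
  by_cases hj : x.1 j = w
  · linarith [clearance_pos h0 hw hj, h0 (x.1 j)]
  · have : 0 < d (x.1 j) := (h0 _).lt_of_ne' fun h => hj ((hw _).1 h)
    linarith [clearance_nonneg h0 j x]

/-- A point with enough pairwise disjoint evasion loops yields an identifying function. -/
theorem exists_isIdentifyingFunction_of_evasionLoops {D : Fin n → Set X}
    (hdisj : Pairwise (Function.onFun Disjoint D)) (hwD : ∀ i, w ∉ D i) (hDo : ∀ i, IsOpen (D i))
    (hDc : ∀ i, closure (D i) ⊆ D i ∪ {w}) (L : ∀ i, EvasionLoop w (D i))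
    (hd : Continuous d) (h0 : ∀ x, 0 ≤ d x) (h1 : ∀ x, d x ≤ 1) (hw : ∀ x, d x = 0 ↔ x = w)
    (hb : ∀ i, d (L i).base = 1) :
    ∃ f : Conf n X → X, IsIdentifyingFunction n X f := by
  classical
  -- Pigeonhole: were every `D i` to hold a token other than `j`, disjointness would make the choice
  -- of tokens injective on `Fin n`, hence surjective, and it would hit `j`.
  have hfree : ∀ (j : Fin n) (x : Conf n X), ∃ i, ∀ l, l ≠ j → x.1 l ∉ D i := by
    intro j x
    by_contra! hcon
    choose g hgj hg using hcon
    have hinj : Function.Injective g := by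
      intro a b hab
      by_contra hne
      exact (Set.disjoint_left.1 (hdisj hne)) (hg a) (hab ▸ hg b)
    obtain ⟨a, ha⟩ := (Finite.injective_iff_surjective.1 hinj) j
    exact hgj a ha
  -- The choice depends on the set of free indices alone, so it is locally constant wherever that
  -- set is. The fallback `j` for an empty set never matters, by `hfree`.
  obtain ⟨pick, hpick⟩ : ∃ pick : Fin n → Set (Fin n) → Fin n,
      ∀ j S, S.Nonempty → pick j S ∈ S := by
    refine ⟨fun j S => if h : S.Nonempty then h.some else j, fun j S h => ?_⟩
    simp only [h, dif_pos]
    exact h.some_mem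
  let free : Fin n → Conf n X → Set (Fin n) := fun j x => {i | ∀ l, l ≠ j → x.1 l ∉ D i}
  let g : Fin n → Conf n X → X := fun j x =>
    (L (pick j (free j x))).evade (x.1 j) (phase d j x)
  have huniq : ∀ (x : Conf n X) (j l : Fin n), d (x.1 j) < clearance d j x →
      d (x.1 l) < clearance d l x → j = l := by
    intro x j l hj hl
    by_contra hne
    have := clearance_le_half h0 h1 hne x
    have := clearance_le_half h0 h1 (Ne.symm hne) x
    linarith [h0 (x.1 j), h0 (x.1 l)]
  let f : Conf n X → X := fun x =>
    if h : ∃ j, d (x.1 j) < clearance d j x then g h.choose x else w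
  have hf : ∀ (x : Conf n X) (j : Fin n), d (x.1 j) < clearance d j x → f x = g j x := by
    intro x j hj
    have h : ∃ j, d (x.1 j) < clearance d j x := ⟨j, hj⟩
    simp only [f, dif_pos h]
    rw [huniq x _ j h.choose_spec hj]
  have hfw : ∀ x : Conf n X, (∀ j, ¬ d (x.1 j) < clearance d j x) → f x = w := by
    intro x h
    simp only [f]
    rw [dif_neg (by simpa using h)]
  refine ⟨f, continuous_iff_continuousAt.2 fun x₀ => ?_, fun x l => ?_⟩
  · by_cases h : ∃ j, d (x₀.1 j) < clearance d j x₀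
    · obtain ⟨j, hj⟩ := h
      have hevU : ∀ᶠ x in 𝓝 x₀, d (x.1 j) < clearance d j x :=
        (isOpen_lt (hd.comp (continuous_token j)) (continuous_clearance hd j)).mem_nhds hj
      -- The tokens other than `j` are off `w`, so they cannot enter or leave any `D i` under a
      -- small perturbation.
      have hevF : ∀ᶠ x in 𝓝 x₀, free j x = free j x₀ := by
        have : ∀ᶠ x : Conf n X in 𝓝 x₀, ∀ i l, l ≠ j → (x.1 l ∈ D i ↔ x₀.1 l ∈ D i) := by
          refine Filter.eventually_all.2 fun i => Filter.eventually_all.2 fun l => ?_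
          by_cases hl : l = j
          · simp [hl]
          · have hlw : x₀.1 l ∉ ({w} : Set X) := by
              intro hlw
              have := clearance_le_half h0 h1 hl x₀
              rw [(hw _).2 hlw] at this
              linarith [h0 (x₀.1 j)]
            filter_upwards [(continuous_token l).continuousAt.eventually
              (eventually_mem_iff_of_closure_subset (hDo i) (hDc i) hlw)] with x hx _
            exact hx
        filter_upwards [this] with x hx
        ext i
        exact forall₂_congr fun l hl => not_congr (hx i l hl)
      have hcont : ContinuousAt (fun x : Conf n X =>
          (L (pick j (free j x₀))).evade (x.1 j) (phase d j x)) x₀ := by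
        refine (L _).continuousAt_evade (continuous_token j).continuousAt
          (continuous_phase hd h0 hw j).continuousAt ?_ ?_
        · intro he
          have := clearance_le h0 h1 j x₀
          rw [he, hb] at hj
          linarith
        · intro he
          simp [phase, (hw _).2 he]
      refine hcont.congr ?_
      filter_upwards [hevU, hevF] with x hxU hxF
      rw [hf x j hxU]
      change _ = (L (pick j (free j x))).evade (x.1 j) (phase d j x)
      rw [hxF]
    · push Not at h
      -- With no token close, every phase is at least one, so all the extended paths already sit at
      -- `w`; nearby values are close to `w` whichever token and loop are selected.
      have hge : ∀ j, 1 ≤ phase d j x₀ := fun j => one_le_phase h0 hw (not_lt.2 (h j))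
      unfold ContinuousAt
      rw [hfw x₀ fun j => not_lt.2 (h j)]
      intro N hN
      have hph : ∀ j, ContinuousAt (phase d j) x₀ := fun j =>
        (continuous_phase hd h0 hw j).continuousAt
      have hev : ∀ᶠ x in 𝓝 x₀, ∀ j i, (L i).escape.extend (phase d j x) ∈ N ∧
          (L i).retreat.extend (phase d j x) ∈ N := by
        refine Filter.eventually_all.2 fun j => Filter.eventually_all.2 fun i => ?_
        refine Filter.Eventually.and ?_ ?_
        · refine ((L i).escape.continuous_extend.continuousAt.comp (hph j)).eventually_mem ?_
          simpa [Path.extend_of_one_le _ (hge j)] using hN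
        · refine ((L i).retreat.continuous_extend.continuousAt.comp (hph j)).eventually_mem ?_
          simpa [Path.extend_of_one_le _ (hge j)] using hN
      refine Filter.mem_map.2 ?_
      filter_upwards [hev] with x hx
      by_cases hU : ∃ j, d (x.1 j) < clearance d j x
      · obtain ⟨j, hj⟩ := hU
        change f x ∈ N
        rw [hf x j hj]
        simp only [g, EvasionLoop.evade]
        split_ifs
        · exact (hx j _).1
        · exact (hx j _).2
      · change f x ∈ N
        rw [hfw x (by simpa using hU)]
        exact mem_of_mem_nhds hN
  · by_cases h : ∃ j, d (x.1 j) < clearance d j x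
    · obtain ⟨j, hj⟩ := h
      rw [hf x j hj]
      by_cases hl : l = j
      · subst hl
        by_cases hlw : x.1 l = w
        · have hp : phase d l x = 0 := by simp [phase, (hw _).2 hlw]
          simp only [g, hp, EvasionLoop.evade_zero, hlw]
          exact fun he => hwD _ (he ▸ (L _).base_mem)
        · refine (L _).evade_ne hlw ?_ _
          intro he
          have := clearance_le h0 h1 l x
          rw [he, hb] at hj
          linarith
      · intro he
        rcases (L (pick j (free j x))).evade_mem (x.1 j) (phase d j x) with hm | hm
        · have := clearance_le_half h0 h1 hl x
          rw [← he, (hw _).2 hm] at this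
          linarith [h0 (x.1 j)]
        · exact hpick j (free j x) (hfree j x) l hl (he ▸ hm)
    · push Not at h
      rw [hfw x fun j => not_lt.2 (h j)]
      intro he
      have := clearance_pos h0 hw he.symm
      have h' := h l
      rw [(hw _).2 he.symm] at h'
      linarith

/-- An identifying function gives a section of the forgetting map. -/
theorem IsIdentifyingFunction.exists_isSection {f : Conf n X → X}
    (hf : IsIdentifyingFunction n X f) : ∃ s, IsSection n X s := by
  refine ⟨fun x => ⟨Fin.snoc (α := fun _ => X) x.1 (f x), ?_⟩, ?_, ?_⟩
  · rw [Fin.snoc_injective_iff]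
    exact ⟨x.2, fun ⟨j, hj⟩ => hf.2 x j hj.symm⟩
  · refine Continuous.subtype_mk (continuous_pi fun i => ?_) _
    induction i using Fin.lastCases with
    | last => simpa using hf.1
    | cast i => simpa only [Fin.snoc_castSucc] using continuous_token i
  · funext x
    apply Subtype.ext
    funext i
    simp [forget]

end Identifying

/-! ### Components of spaces with a finite closed cover by joined pieces -/

section PathComponents

variable {Y ι : Type*} [TopologicalSpace Y] [Finite ι] {K : ι → Set Y}

/-- In a space covered by finitely many closed sets whose points are pairwise joined, a union of
path components is closed. -/
theorem isClosed_of_joined_saturated (hK : ∀ i, IsClosed (K i))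
    (hj : ∀ i, ∀ x ∈ K i, ∀ y ∈ K i, Joined x y) (hU : ⋃ i, K i = univ) {P : Set Y}
    (hP : ∀ x y, Joined x y → x ∈ P → y ∈ P) : IsClosed P := by
  have : P = ⋃ i ∈ {i | (K i ∩ P).Nonempty}, K i := by
    ext y
    simp only [mem_ofPred_eq, mem_iUnion, exists_prop]
    constructor
    · intro hy
      obtain ⟨i, hi⟩ := mem_iUnion.1 (hU.symm ▸ mem_univ y : y ∈ ⋃ i, K i)
      exact ⟨i, ⟨y, hi, hy⟩, hi⟩
    · rintro ⟨i, ⟨x, hx, hxP⟩, hy⟩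
      exact hP x y (hj i x hx y hy) hxP
  rw [this]
  exact (Set.toFinite _).isClosed_biUnion fun i _ => hK i

theorem isClopen_pathComponent_of_cover (hK : ∀ i, IsClosed (K i))
    (hj : ∀ i, ∀ x ∈ K i, ∀ y ∈ K i, Joined x y) (hU : ⋃ i, K i = univ) (x : Y) :
    IsClopen (pathComponent x) := by
  refine ⟨isClosed_of_joined_saturated hK hj hU fun a b hab ha => ?_, ?_⟩
  · exact Joined.trans ha hab
  · rw [← isClosed_compl_iff]
    refine isClosed_of_joined_saturated hK hj hU fun a b hab ha hb => ha ?_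
    exact Joined.trans hb hab.symm

theorem connectedComponent_eq_pathComponent_of_cover (hK : ∀ i, IsClosed (K i))
    (hj : ∀ i, ∀ x ∈ K i, ∀ y ∈ K i, Joined x y) (hU : ⋃ i, K i = univ) (x : Y) :
    connectedComponent x = pathComponent x :=
  ((isClopen_pathComponent_of_cover hK hj hU x).connectedComponent_subset
    (mem_pathComponent_self x)).antisymm (pathComponent_subset_component x)

end PathComponents

/-- Removing a fibre from a compact set leaves a σ-compact set. -/
theorem isSigmaCompact_inter_preimage_compl_singleton {E X : Type*} [PseudoMetricSpace E]
    [TopologicalSpace X] [T1Space X] {s : Set E} (hs : IsCompact s) {f : E → X}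
    (hf : ContinuousOn f s) (w : X) : IsSigmaCompact (s ∩ f ⁻¹' {w}ᶜ) := by
  obtain ⟨u, hu, hus⟩ := continuousOn_iff'.1 hf {w}ᶜ isOpen_compl_singleton
  -- An open subset of a pseudometric space is a countable union of closed sets, and each of these
  -- meets `s` in a compact set.
  obtain ⟨F, hF, -, hFu, -⟩ := hu.exists_iUnion_isClosed
  rw [inter_comm, hus, ← hFu, iUnion_inter]
  exact isSigmaCompact_iUnion_of_isCompact _ fun n => hs.inter_left (hF n)

/-! ### Topology of a graph with a vertex removed -/

section Graph

open RelCWComplex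

variable {G : Type*} [TopologicalSpace G] [CWComplex (univ : Set G)] {w : G}

theorem IsVertex.notMem_openCell_one (hw : IsVertex w) (e : cell (univ : Set G) 1) :
    w ∉ openCell 1 e := by
  obtain ⟨v, hv⟩ := hw
  rw [closedCell_zero_eq_singleton, ← openCell_zero_eq_singleton] at hv
  have : w ∈ openCell 0 v := hv ▸ rfl
  exact disjoint_left.1 (disjoint_openCell_of_ne (by simp)) this

theorem disjoint_cellFrontier_openCell_one (c e : cell (univ : Set G) 1) :
    Disjoint (cellFrontier 1 c) (openCell 1 e) := by
  obtain ⟨x, y, h⟩ := CWComplex.exists_cellFrontier_one_eq c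
  rw [h, closedCell_zero_eq_singleton, ← openCell_zero_eq_singleton,
    closedCell_zero_eq_singleton, ← openCell_zero_eq_singleton, disjoint_union_left]
  exact ⟨disjoint_openCell_of_ne (by simp), disjoint_openCell_of_ne (by simp)⟩

theorem iUnion_sigma_closedCell : ⋃ c : Σ n, cell (univ : Set G) n, closedCell c.1 c.2 = univ := by
  rw [iUnion_sigma, CWComplex.union]

theorem iUnion_preimage_closedCell :
    ⋃ c : Σ n, cell (univ : Set G) n, ((↑) ⁻¹' closedCell c.1 c.2 : Set ({w}ᶜ : Set G)) = univ := by
  rw [← preimage_iUnion, iUnion_sigma_closedCell, preimage_univ]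

namespace IsGraph

theorem finite_sigma_cell (hG : IsGraph G) : Finite (Σ n, cell (univ : Set G) n) :=
  have := hG.finite
  finite_cells_of_finite

theorem compactSpace (hG : IsGraph G) : CompactSpace G := by
  have := hG.finite_sigma_cell
  rw [← isCompact_univ_iff, ← iUnion_sigma_closedCell]
  exact isCompact_iUnion fun _ => isCompact_closedCell

theorem disjoint_closedCell_openCell_one (hG : IsGraph G) (e : cell (univ : Set G) 1)
    {c : Σ n, cell (univ : Set G) n} (hc : c ≠ ⟨1, e⟩) :
    Disjoint (closedCell c.1 c.2) (openCell 1 e) := by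
  obtain ⟨n, c⟩ := c
  match n, c with
  | 0, c =>
    rw [closedCell_zero_eq_singleton, ← openCell_zero_eq_singleton]
    exact disjoint_openCell_of_ne hc
  | 1, c =>
    rw [← cellFrontier_union_openCell_eq_closedCell, disjoint_union_left]
    exact ⟨disjoint_cellFrontier_openCell_one c e, disjoint_openCell_of_ne hc⟩
  | n + 2, c => exact ((hG.dim_le_one (n + 2) (by lia)).false c).elim

/-- The characteristic map of an edge is open on the open cell. -/
theorem isOpen_image_map_one (hG : IsGraph G) (e : cell (univ : Set G) 1)
    {U : Set (Fin 1 → ℝ)} (hU : IsOpen U)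
    (hUb : U ⊆ ball 0 1) : IsOpen (map 1 e '' U) := by
  have := hG.t2
  have := hG.finite_sigma_cell
  -- The complement is a finite union of closed sets: the compact image of the rest of the closed
  -- ball, and the other closed cells, which miss the open edge.
  have hcompl : (map 1 e '' U)ᶜ =
      map 1 e '' (closedBall 0 1 \ U) ∪ ⋃ c ∈ ({⟨1, e⟩}ᶜ : Set (Σ n, cell (univ : Set G) n)),
        closedCell c.1 c.2 := by
    refine Subset.antisymm (fun x hx => ?_) (union_subset ?_ (iUnion₂_subset fun c hc => ?_))
    · obtain ⟨c, hc⟩ := mem_iUnion.1 ((iUnion_sigma_closedCell (G := G)).symm ▸ mem_univ x :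
        x ∈ ⋃ c : Σ n, cell (univ : Set G) n, closedCell c.1 c.2)
      by_cases hce : c = ⟨1, e⟩
      · subst hce
        obtain ⟨b, hb, rfl⟩ := hc
        exact Or.inl ⟨b, ⟨hb, fun hbU => hx ⟨b, hbU, rfl⟩⟩, rfl⟩
      · exact Or.inr (mem_biUnion (by simpa using hce) hc)
    · rintro _ ⟨b, ⟨hb, hbU⟩, rfl⟩ ⟨b', hb', he⟩
      rw [← sphere_union_ball] at hb
      rcases hb with hb | hb
      · exact disjoint_left.1 (disjoint_cellFrontier_openCell_one e e) ⟨b, hb, rfl⟩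
          ⟨b', hUb hb', he⟩
      · refine hbU ((map 1 e).injOn ?_ ?_ he ▸ hb')
        · rw [source_eq]; exact hUb hb'
        · rwa [source_eq]
    · rintro x hx ⟨b, hb, rfl⟩
      exact disjoint_left.1 (hG.disjoint_closedCell_openCell_one e hc) hx ⟨b, hUb hb, rfl⟩
  rw [← isClosed_compl_iff, hcompl]
  refine IsClosed.union ?_ ((Set.toFinite _).isClosed_biUnion fun c _ => isClosed_closedCell)
  exact (((isCompact_closedBall _ _).diff hU).image_of_continuousOn
    ((continuousOn 1 e).mono sdiff_subset)).isClosed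

/-- Removing a vertex from a closed edge deletes at most endpoints of the parametrizing ball, and
what is left is star-shaped about its centre. -/
theorem joined_of_mem_closedCell (hG : IsGraph G) (hw : IsVertex w) (c : Σ n, cell (univ : Set G) n)
    (x y : ({w}ᶜ : Set G)) (hx : x.1 ∈ closedCell c.1 c.2) (hy : y.1 ∈ closedCell c.1 c.2) :
    Joined x y := by
  obtain ⟨n, c⟩ := c
  match n, c with
  | 0, c =>
    rw [closedCell_zero_eq_singleton] at hx hy
    rw [Subtype.ext (hx.trans hy.symm)]
  | 1, c =>
    have hpc : IsPathConnected (map 1 c '' (closedBall 0 1 ∩ map 1 c ⁻¹' {w}ᶜ)) := by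
      have hball : ∀ b ∈ ball (0 : Fin 1 → ℝ) 1, map 1 c b ≠ w := fun b hb he =>
        hw.notMem_openCell_one c ⟨b, hb, he⟩
      refine IsPathConnected.image' (StarConvex.isPathConnected (a := 0) ?_ ?_)
        ((continuousOn 1 c).mono inter_subset_left)
      · rw [starConvex_zero_iff]
        rintro b ⟨hb, hbw⟩ t ht0 ht1
        rcases ht1.eq_or_lt with rfl | ht1
        · simpa using ⟨by simpa using hb, hbw⟩
        · have : t • b ∈ ball (0 : Fin 1 → ℝ) 1 := by
            rw [mem_closedBall_zero_iff] at hb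
            rw [mem_ball_zero_iff, norm_smul, Real.norm_of_nonneg ht0]
            nlinarith [norm_nonneg b]
          exact ⟨ball_subset_closedBall this, hball _ this⟩
      · exact ⟨by simp, hball 0 (by simp)⟩
    have hmem : ∀ z : ({w}ᶜ : Set G), z.1 ∈ closedCell 1 c →
        z.1 ∈ map 1 c '' (closedBall 0 1 ∩ map 1 c ⁻¹' {w}ᶜ) := by
      rintro ⟨_, hz⟩ ⟨b, hb, rfl⟩
      exact ⟨b, ⟨hb, hz⟩, rfl⟩
    have hj := hpc.joinedIn _ (hmem x hx) _ (hmem y hy)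
    refine (joinedIn_iff_joined x.2 y.2).1 (hj.mono ?_)
    rintro _ ⟨b, ⟨-, hb⟩, rfl⟩
    exact hb
  | n + 2, c => exact ((hG.dim_le_one (n + 2) (by lia)).false c).elim

theorem isClosed_preimage_closedCell (hG : IsGraph G) (c : Σ n, cell (univ : Set G) n) :
    IsClosed ((↑) ⁻¹' closedCell c.1 c.2 : Set ({w}ᶜ : Set G)) :=
  have := hG.t2
  isClosed_closedCell.preimage continuous_subtype_val

theorem isClopen_connectedComponent (hG : IsGraph G) (hw : IsVertex w) (x : ({w}ᶜ : Set G)) :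
    IsClopen (connectedComponent x) := by
  have := hG.finite_sigma_cell
  rw [connectedComponent_eq_pathComponent_of_cover hG.isClosed_preimage_closedCell
    (fun c x hx y hy => hG.joined_of_mem_closedCell hw c x y hx hy) iUnion_preimage_closedCell]
  exact isClopen_pathComponent_of_cover hG.isClosed_preimage_closedCell
    (fun c x hx y hy => hG.joined_of_mem_closedCell hw c x y hx hy) iUnion_preimage_closedCell x

theorem isOpen_connectedComponentIn (hG : IsGraph G) (hw : IsVertex w) {x : G} (hx : x ∈ ({w}ᶜ : Set G)) :
    IsOpen (connectedComponentIn {w}ᶜ x) := by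
  have := hG.t2
  rw [connectedComponentIn_eq_image hx]
  exact isOpen_compl_singleton.isOpenMap_subtype_val _
    (hG.isClopen_connectedComponent hw ⟨x, hx⟩).isOpen

theorem closure_connectedComponentIn_subset (hG : IsGraph G) (hw : IsVertex w) {x : G}
    (hx : x ∈ ({w}ᶜ : Set G)) :
    closure (connectedComponentIn {w}ᶜ x) ⊆ connectedComponentIn {w}ᶜ x ∪ {w} := by
  intro z hz
  by_cases hzw : z = w
  · exact Or.inr hzw
  left
  rw [connectedComponentIn_eq_image hx] at hz ⊢
  refine ⟨⟨z, hzw⟩, ?_, rfl⟩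
  rw [← (hG.isClopen_connectedComponent hw ⟨x, hx⟩).isClosed.closure_eq, closure_subtype]
  exact hz

theorem exists_path_of_mem_connectedComponentIn (hG : IsGraph G) (hw : IsVertex w) {x p q : G}
    (hp : p ∈ connectedComponentIn {w}ᶜ x) (hq : q ∈ connectedComponentIn {w}ᶜ x) :
    ∃ γ : Path p q, ∀ t, γ t ∈ connectedComponentIn {w}ᶜ x := by
  have := hG.finite_sigma_cell
  have hpw := connectedComponentIn_subset _ _ hp
  rw [connectedComponentIn_eq hp] at hq ⊢
  rw [connectedComponentIn_eq_image hpw, connectedComponent_eq_pathComponent_of_cover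
    hG.isClosed_preimage_closedCell
    (fun c x hx y hy => hG.joined_of_mem_closedCell hw c x y hx hy)
    iUnion_preimage_closedCell] at hq
  obtain ⟨q, ⟨γ⟩, rfl⟩ := hq
  refine ⟨γ.map continuous_subtype_val, fun t => ?_⟩
  have hr := (isPreconnected_range
    (γ.map continuous_subtype_val).continuous).subset_connectedComponentIn
      (F := {w}ᶜ) (x := p) ⟨0, by simp⟩ ?_
  · exact hr ⟨t, rfl⟩
  · rintro _ ⟨t, rfl⟩
    exact (γ t).2

/-- Each closed cell minus `w` is σ-compact and there are finitely many cells, so the complement of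
`w` is a countable union of closed sets. -/
theorem isGδ_singleton (hG : IsGraph G) (w : G) : IsGδ ({w} : Set G) := by
  have := hG.t2
  have := hG.finite_sigma_cell
  have hσ : IsSigmaCompact ({w}ᶜ : Set G) := by
    have : ({w}ᶜ : Set G) = ⋃ c : Σ n, cell (univ : Set G) n,
        map c.1 c.2 '' (closedBall 0 1 ∩ map c.1 c.2 ⁻¹' {w}ᶜ) := by
      simp_rw [image_inter_preimage]
      rw [← iUnion_inter]
      change _ = (⋃ c : Σ n, cell (univ : Set G) n, closedCell c.1 c.2) ∩ _
      rw [iUnion_sigma_closedCell, univ_inter]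
    rw [this]
    refine isSigmaCompact_iUnion _ fun c => ?_
    exact (isSigmaCompact_inter_preimage_compl_singleton (isCompact_closedBall _ _)
      (continuousOn c.1 c.2) w).image_of_continuousOn
        ((continuousOn c.1 c.2).mono inter_subset_left)
  obtain ⟨K, hK, hKw⟩ := hσ
  rw [← compl_compl ({w} : Set G), ← hKw, compl_iUnion]
  exact .iInter_of_isOpen fun n => (hK n).isClosed.isOpen_compl

/-- This stands in for a distance to `w`: in a compact Hausdorff space, Urysohn's lemma for a Gδ set
gives a function vanishing exactly there. The set `F` will be the bases of the loops. -/
theorem exists_continuous_eq_zero_iff (hG : IsGraph G) (w : G) {F : Set G} (hF : F.Finite)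
    (hwF : w ∉ F) :
    ∃ d : G → ℝ, Continuous d ∧ (∀ x, 0 ≤ d x) ∧ (∀ x, d x ≤ 1) ∧ (∀ x, d x = 0 ↔ x = w) ∧
      ∀ x ∈ F, d x = 1 := by
  have := hG.t2
  have := hG.compactSpace
  obtain ⟨f, hfw, hfF, -, hf⟩ := exists_continuous_one_zero_of_isCompact_of_isGδ
    (isCompact_singleton (x := w)) (hG.isGδ_singleton w) hF.isClosed
    (disjoint_singleton_left.2 hwF)
  refine ⟨fun x => 1 - f x, by fun_prop, fun x => by linarith [(hf x).2],
    fun x => by linarith [(hf x).1], fun x => ?_, fun x hx => by simp [hfF hx]⟩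
  have : x = w ↔ f x = 1 := by rw [← mem_singleton_iff, hfw]; rfl
  rw [this, sub_eq_zero, eq_comm]

end IsGraph

end Graph

theorem norm_fin_one (b : Fin 1 → ℝ) : ‖b‖ = |b 0| := by
  simp [Pi.norm_def]

/-! ### Evasion loops from doubly attached components -/

section Graph

open RelCWComplex

variable {G : Type*} [TopologicalSpace G] [CWComplex (univ : Set G)] {w : G}

/-- The path along an edge from its midpoint to one of its ends. -/
def radialPath (e : cell (univ : Set G) 1) {s : Fin 1 → ℝ} (hs : s ∈ sphere (0 : Fin 1 → ℝ) 1)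
    (hsw : map 1 e s = w) : Path (map 1 e 0) w where
  toFun t := map 1 e ((t : ℝ) • s)
  continuous_toFun := by
    refine (continuousOn 1 e).comp_continuous (by fun_prop) fun t => ?_
    rw [mem_closedBall_zero_iff, norm_smul, mem_sphere_zero_iff_norm.1 hs, mul_one,
      Real.norm_of_nonneg t.2.1]
    exact t.2.2
  source' := by simp
  target' := by simpa using hsw

theorem radialPath_apply (e : cell (univ : Set G) 1) {s : Fin 1 → ℝ}
    (hs : s ∈ sphere (0 : Fin 1 → ℝ) 1) (hsw : map 1 e s = w) (t : unitInterval) :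
    radialPath e hs hsw t = map 1 e ((t : ℝ) • s) := rfl

/-- The open half of an edge next to the end `s`. -/
def openHalf (e : cell (univ : Set G) 1) (s : Fin 1 → ℝ) : Set G :=
  map 1 e '' {b | b ∈ ball 0 1 ∧ 0 < b 0 * s 0}

theorem openHalf_subset_openCell (e : cell (univ : Set G) 1) (s : Fin 1 → ℝ) :
    openHalf e s ⊆ openCell 1 e :=
  image_mono fun _ h => h.1

theorem map_mem_openHalf_iff (e : cell (univ : Set G) 1) (s : Fin 1 → ℝ) {b : Fin 1 → ℝ}
    (hb : b ∈ ball (0 : Fin 1 → ℝ) 1) : map 1 e b ∈ openHalf e s ↔ 0 < b 0 * s 0 := by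
  refine ⟨?_, fun h => ⟨b, ⟨hb, h⟩, rfl⟩⟩
  rintro ⟨b', ⟨hb', hs'⟩, he⟩
  rwa [← (map 1 e).injOn (by rwa [source_eq]) (by rwa [source_eq]) he]

theorem smul_mem_ball {s : Fin 1 → ℝ} (hs : s ∈ sphere (0 : Fin 1 → ℝ) 1) {t : unitInterval}
    (ht : t ≠ 1) : (t : ℝ) • s ∈ ball (0 : Fin 1 → ℝ) 1 := by
  rw [mem_ball_zero_iff, norm_smul, mem_sphere_zero_iff_norm.1 hs, mul_one,
    Real.norm_of_nonneg t.2.1]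
  exact unitInterval.lt_one_iff_ne_one.2 ht

theorem radialPath_mem_openCell (e : cell (univ : Set G) 1) {s : Fin 1 → ℝ}
    (hs : s ∈ sphere (0 : Fin 1 → ℝ) 1) (hsw : map 1 e s = w) {t : unitInterval} (ht : t ≠ 1) :
    radialPath e hs hsw t ∈ openCell 1 e :=
  ⟨_, smul_mem_ball hs ht, rfl⟩

theorem mul_self_of_mem_sphere {s : Fin 1 → ℝ} (hs : s ∈ sphere (0 : Fin 1 → ℝ) 1) :
    s 0 * s 0 = 1 := by
  rw [mem_sphere_zero_iff_norm, norm_fin_one] at hs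
  rw [← abs_mul_abs_self, hs, one_mul]

theorem radialPath_mem_openHalf (e : cell (univ : Set G) 1) {s : Fin 1 → ℝ}
    (hs : s ∈ sphere (0 : Fin 1 → ℝ) 1) (hsw : map 1 e s = w) (t : unitInterval) :
    radialPath e hs hsw t ∈ insert w (insert (map 1 e 0) (openHalf e s)) := by
  by_cases h1 : t = 1
  · exact Or.inl (by rw [h1, Path.target])
  by_cases h0 : t = 0
  · exact Or.inr (Or.inl (by rw [h0, Path.source]))
  refine Or.inr (Or.inr ((map_mem_openHalf_iff e s (smul_mem_ball hs h1)).2 ?_))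
  have : 0 < (t : ℝ) := unitInterval.pos_iff_ne_zero.2 h0
  simpa [mul_assoc, mul_self_of_mem_sphere hs] using this

/-- The path to a different end avoids the open half. -/
theorem radialPath_notMem_openHalf (hw : IsVertex w) {e e' : cell (univ : Set G) 1}
    {s s' : Fin 1 → ℝ} (hs : s ∈ sphere (0 : Fin 1 → ℝ) 1) (hs' : s' ∈ sphere (0 : Fin 1 → ℝ) 1)
    (hsw : map 1 e' s' = w) (hne : (e, s) ≠ (e', s')) (t : unitInterval) :
    radialPath e' hs' hsw t ∉ openHalf e s := by
  intro hmem
  by_cases h1 : t = 1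
  · rw [h1, Path.target] at hmem
    exact hw.notMem_openCell_one e (openHalf_subset_openCell e s hmem)
  by_cases he : e = e'
  · subst he
    rw [radialPath_apply, map_mem_openHalf_iff e s (smul_mem_ball hs' h1)] at hmem
    have hss : s 0 ≠ s' 0 := fun h => hne (by
      congr 1
      ext i
      rwa [Subsingleton.elim i 0])
    -- Two different ends of the same edge are the opposite points of the zero-sphere.
    have hopp : s 0 = - s' 0 := by
      have := (mul_self_of_mem_sphere hs).trans (mul_self_of_mem_sphere hs').symm
      exact (mul_self_eq_mul_self_iff.1 this).resolve_left hss
    simp only [Pi.smul_apply, smul_eq_mul, hopp] at hmem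
    nlinarith [mul_self_of_mem_sphere hs', t.2.1]
  · exact disjoint_left.1 (disjoint_openCell_of_ne (by simpa using he))
      (openHalf_subset_openCell e s hmem) (radialPath_mem_openCell e' hs' hsw h1)

namespace IsGraph

theorem isOpen_openHalf (hG : IsGraph G) (e : cell (univ : Set G) 1) (s : Fin 1 → ℝ) :
    IsOpen (openHalf e s) :=
  hG.isOpen_image_map_one e
    (isOpen_ball.inter (isOpen_lt continuous_const
      (by fun_prop : Continuous fun b : Fin 1 → ℝ => b 0 * s 0))) fun _ h => h.1

theorem closure_openHalf_subset (hG : IsGraph G) (e : cell (univ : Set G) 1) {s : Fin 1 → ℝ}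
    (hs : s ∈ sphere (0 : Fin 1 → ℝ) 1) (hsw : map 1 e s = w) :
    closure (openHalf e s) ⊆ openHalf e s ∪ {map 1 e 0, w} := by
  have := hG.t2
  have hcl : IsClosed (map 1 e '' (closedBall 0 1 ∩ {b | 0 ≤ b 0 * s 0})) :=
    (((isCompact_closedBall _ _).inter_right
      (isClosed_le continuous_const (by fun_prop))).image_of_continuousOn
        ((continuousOn 1 e).mono inter_subset_left)).isClosed
  refine (closure_minimal (image_mono fun b hb => ?_) hcl).trans ?_
  · exact ⟨ball_subset_closedBall hb.1, hb.2.le⟩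
  rintro _ ⟨b, ⟨hb, hbs⟩, rfl⟩
  have hs2 := mul_self_of_mem_sphere hs
  rcases (show 0 ≤ b 0 * s 0 from hbs).eq_or_lt with h | h
  · have hb0 : b 0 = 0 := (mul_eq_zero.1 h.symm).resolve_right fun h => by simp [h] at hs2
    have : b = 0 := by
      ext i
      rw [Subsingleton.elim i 0, hb0]
      rfl
    simp [this]
  · rw [← sphere_union_ball] at hb
    rcases hb with hb | hb
    · have hb2 := mul_self_of_mem_sphere hb
      have hb0 : b 0 = s 0 :=
        (mul_self_eq_mul_self_iff.1 (hb2.trans hs2.symm)).resolve_right fun h' => by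
          rw [h'] at h
          linarith
      have : b = s := by
        ext i
        rw [Subsingleton.elim i 0, hb0]
      simp [this, hsw]
    · exact Or.inl ⟨b, ⟨hb, h⟩, rfl⟩

/-- Collapsing an open half edge to the midpoint of the edge is continuous away from `w`. -/
theorem exists_collapse (hG : IsGraph G) (e : cell (univ : Set G) 1) {s : Fin 1 → ℝ}
    (hs : s ∈ sphere (0 : Fin 1 → ℝ) 1) (hsw : map 1 e s = w) :
    ∃ ρ : G → G, ContinuousOn ρ {w}ᶜ ∧ (∀ x, ρ x ∉ openHalf e s) ∧
      (∀ x, ρ x = map 1 e 0 ∨ ρ x = x) ∧ ∀ x ∉ openHalf e s, ρ x = x := by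
  classical
  have hp : map 1 e 0 ∉ openHalf e s := by
    rw [map_mem_openHalf_iff e s (by simp)]
    simp
  refine ⟨fun x => if x ∈ openHalf e s then map 1 e 0 else x, fun z hz => ?_, fun x => ?_,
    fun x => ?_, fun x hx => if_neg hx⟩
  · refine ContinuousAt.continuousWithinAt ?_
    by_cases hzp : z = map 1 e 0
    · simp only [ContinuousAt, hzp, ite_self]
      exact tendsto_const_nhds.if' Filter.tendsto_id
    · have hev := eventually_mem_iff_of_closure_subset (hG.isOpen_openHalf e s)
        (hG.closure_openHalf_subset e hs hsw) (z := z)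
        (fun h => h.elim hzp hz)
      by_cases hzA : z ∈ openHalf e s
      · refine (continuousAt_const (y := map 1 e 0)).congr ?_
        filter_upwards [hev] with x hx
        rw [if_pos (hx.2 hzA)]
      · refine continuousAt_id.congr ?_
        filter_upwards [hev] with x hx
        rw [if_neg fun h => hzA (hx.1 h), id]
  · dsimp only
    split_ifs with h
    exacts [hp, h]
  · dsimp only
    split_ifs
    exacts [Or.inl rfl, Or.inr rfl]

/-- A doubly attached component carries an evasion loop. -/
theorem nonempty_evasionLoop (hG : IsGraph G) (hw : IsVertex w) {C : Set G}
    (hC : C ∈ doublyAttachedComponents w) : Nonempty (EvasionLoop w C) := by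
  obtain ⟨⟨x, -, rfl⟩, hends⟩ := hC
  obtain ⟨⟨e, s⟩, ⟨e', s'⟩, ⟨hs, hsw, heC⟩, ⟨hs', hsw', heC'⟩, hne⟩ :=
    one_lt_encard_iff.1 (lt_of_lt_of_le (by norm_num) hends)
  dsimp only at hs hsw heC hs' hsw' heC'
  obtain ⟨γ, hγ⟩ := hG.exists_path_of_mem_connectedComponentIn hw
    (heC (map_zero_mem_openCell 1 e)) (heC' (map_zero_mem_openCell 1 e'))
  obtain ⟨ρ, hρc, hρA, hρ, hρid⟩ := hG.exists_collapse e hs hsw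
  have hp : map 1 e 0 ∉ openHalf e s := by
    rw [map_mem_openHalf_iff e s (by simp)]
    simp
  have hq : map 1 e' 0 ∉ openHalf e s := by
    simpa using radialPath_notMem_openHalf hw hs hs' hsw' hne 0
  -- The path between the two midpoints may cross the arm. Collapsing the arm pushes it off while
  -- fixing both ends, and it avoids `w`, the only place where the collapse may be discontinuous.
  let α : Path (map 1 e 0) (map 1 e' 0) := (γ.map' (hρc.mono (by
    rintro _ ⟨t, rfl⟩
    exact connectedComponentIn_subset _ _ (hγ t)))).cast (hρid _ hp).symm (hρid _ hq).symm
  have hα : ∀ t, α t = ρ (γ t) := fun t => rfl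
  have hmem : ∀ t, (α.trans (radialPath e' hs' hsw')) t ∈
      range α ∪ range (radialPath e' hs' hsw') := fun t => by
    rw [← Path.trans_range]
    exact mem_range_self t
  refine ⟨{
    base := map 1 e 0
    arm := openHalf e s
    escape := α.trans (radialPath e' hs' hsw')
    retreat := radialPath e hs hsw
    base_mem := heC (map_zero_mem_openCell 1 e)
    isOpen_arm := hG.isOpen_openHalf e s
    closure_arm := hG.closure_openHalf_subset e hs hsw
    arm_subset := (openHalf_subset_openCell e s).trans heC
    escape_mem := fun t => ?_
    escape_notMem_arm := fun t => ?_
    retreat_mem := radialPath_mem_openHalf e hs hsw }⟩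
  · rcases hmem t with ⟨u, hu⟩ | ⟨u, hu⟩
    · rw [← hu, hα]
      right
      rcases hρ (γ u) with h | h
      · rw [h]; exact heC (map_zero_mem_openCell 1 e)
      · rw [h]; exact hγ u
    · rw [← hu]
      by_cases h1 : u = 1
      · left; rw [h1, Path.target]
      · exact Or.inr (heC' (radialPath_mem_openCell e' hs' hsw' h1))
  · rcases hmem t with ⟨u, hu⟩ | ⟨u, hu⟩
    · rw [← hu, hα]
      exact hρA _
    · rw [← hu]
      exact radialPath_notMem_openHalf hw hs hs' hsw' hne u

end IsGraph

end Graph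

end GraphConf

theorem mainTheorem4 {G : Type*} [TopologicalSpace G] [CWComplex (Set.univ : Set G)]
    (hG : GraphConf.IsGraph G) (w : G) (hw : GraphConf.IsVertex w) (n k : ℕ)
    (hk : (k : ℕ∞) ≤ (GraphConf.doublyAttachedComponents w).encard) (hn : n ≤ k) :
    (∃ f : GraphConf.Conf n G → G, GraphConf.IsIdentifyingFunction n G f) ∧
      ∃ s : GraphConf.Conf n G → GraphConf.Conf (n + 1) G, GraphConf.IsSection n G s := by
  suffices h : ∃ f : GraphConf.Conf n G → G, GraphConf.IsIdentifyingFunction n G f from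
    ⟨h, h.elim fun f hf => hf.exists_isSection⟩
  have hnk : (n : ℕ∞) ≤ (GraphConf.doublyAttachedComponents w).encard :=
    le_trans (by exact_mod_cast hn) hk
  obtain ⟨S, hS, hSn⟩ := Set.exists_subset_encard_eq hnk
  have hSfin : S.Finite := Set.finite_of_encard_eq_coe hSn
  have hcard : Nat.card S = n := by
    rw [Nat.card_coe_set_eq, Set.ncard_def, hSn, ENat.toNat_natCast]
  have := hSfin.to_subtype
  let D : Fin n ≃ S := (Finite.equivFinOfCardEq hcard).symm
  have hD : ∀ i, (D i).1 ∈ GraphConf.doublyAttachedComponents w := fun i => hS (D i).2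
  choose x hx hDx using fun i => (hD i).1
  have hwD : ∀ i, w ∉ (D i).1 := fun i hi => by
    rw [hDx i] at hi
    exact connectedComponentIn_subset _ _ hi rfl
  let L : ∀ i, GraphConf.EvasionLoop w (D i).1 := fun i =>
    (hG.nonempty_evasionLoop hw (hD i)).some
  -- Value one at every base keeps the bases beyond the clearance, which is at most one half.
  obtain ⟨d, hd, h0, h1, hdw, hdF⟩ := hG.exists_continuous_eq_zero_iff w
    (Set.finite_range fun i => (L i).base) (by
      rintro ⟨i, hi⟩
      exact hwD i (hi ▸ (L i).base_mem))
  refine GraphConf.exists_isIdentifyingFunction_of_evasionLoops (D := fun i => (D i).1) ?_ hwD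
    (fun i => ?_) (fun i => ?_) L hd h0 h1 hdw fun i => hdF _ ⟨i, rfl⟩
  · intro i j hij
    by_contra hnd
    obtain ⟨z, hzi, hzj⟩ := Set.not_disjoint_iff.1 hnd
    refine hij (D.injective (Subtype.ext ?_))
    dsimp only at hzi hzj
    rw [hDx i] at hzi ⊢
    rw [hDx j] at hzj ⊢
    rw [connectedComponentIn_eq hzi, connectedComponentIn_eq hzj]
  · rw [hDx i]
    exact hG.isOpen_connectedComponentIn hw (hx i)
  · rw [hDx i]
    exact hG.closure_connectedComponentIn_subset hw (hx i)
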